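/- Let $n\ge 1$ and write points of $\mathbb R^{n+1}$ as $X=(x,t)$ with $x\in\mathbb R^n$, $t\in\mathbb R$. Let $|\cdot|$ denote Lebesgue measure on $\mathbb R^{n+1}$, let $F(x,t)=(4\pi t)^{-n/2}e^{-|x|^2/(4t)}$ for $t>0$ and $F(x,t)=0$ for $t\le 0$, and for $Y=(y,s)$ and $r>0$ let $C_r(Y)=\{(x,t): |x-y|<r,\ s-r^2<t<s\}$. For a set $K\subset\mathbb R^{n+1}$ let $$\mathrm{cap}(K)=\sup\{\mu(\mathbb R^{n+1}) : \mu \text{ a nonnegative Radon measure carried by } K \text{ (i.e. } \mu(K^c)=0),\ F*\mu\le 1 \text{ on } \mathbb R^{n+1}\}.$$ Let $Q\subset\mathbb R^{n+1}$ be open. Its parabolic boundary $\partial_pQ$ is the set of all $(x_0,t_0)\in\partial Q$ for which there are $\delta>0$ and a continuous function $x:[t_0,t_0+\delta)\to\mathbb R^n$ with $x(t_0)=x_0$ and $(x(t),t)\in Q$ for all $t\in(t_0,t_0+\delta)$. $Q$ satisfies condition (A) if there is $\theta_0\in(0,1)$ such that $|C_r(Y_0)\setminus Q|>\theta_0|C_r(Y_0)|$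 for all $Y_0\in\partial_pQ$ and $r>0$. $Q$ satisfies condition (B) if there is $\theta_1\in(0,1)$ such that for every $Y_0\in\partial_pQ$ and every $\lambda>1$ there is an integer $k_0\ge 1$ with $$\bigl|\{Y:\lambda^{k_0(k+1)}\ge F(Y_0-Y)\ge\lambda^{k_0k}\}\setminus Q\bigr|>\theta_1\bigl|\{Y:\lambda^{k_0(k+1)}\ge F(Y_0-Y)\ge\lambda^{k_0k}\}\bigr|\quad\text{for all integers } k\ge 1.$$ A point $X_0\in\partial_pQ$ is called (Wiener-)regular for the heat equation if it satisfies the Evans–Gariepy form of Wiener's criterion: for every $\lambda>1$, $$\sum_{k=1}^{\infty}\lambda^k\,\mathrm{cap}\bigl(Q^c\cap\{X:\lambda^{k+1}\ge F(X_0-X)\ge\lambda^k\}\bigr)=\infty .$$ **Theorem.** If $Q$ satisfies condition (B), then every point of $\partial_pQ$ is regular. Moreover, if $Q$ satisfies condition (A), then every point of $\partial_pQ$ is regular. -/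

import Mathlib

open MeasureTheory Set
open scoped ENNReal

noncomputable section

namespace ThermalWiener

/-- Space-time `ℝⁿ⁺¹ = ℝⁿ × ℝ`; a point is `X = (x, t)`, with the Euclidean norm on `ℝⁿ`.
Its `volume` is the `(n+1)`-dimensional Lebesgue measure. -/
abbrev SpaceTime (n : ℕ) : Type := EuclideanSpace ℝ (Fin n) × ℝ

variable {n : ℕ}

/-- The fundamental solution of the heat equation:
`F(x,t) = (4πt)^(-n/2) exp(-|x|²/(4t))` for `t > 0` and `F(x,t) = 0` for `t ≤ 0`. -/
def heatKernel (X : SpaceTime n) : ℝ :=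
  if 0 < X.2 then
    (4 * Real.pi * X.2) ^ (-(n : ℝ) / 2) * Real.exp (-(‖X.1‖ ^ 2 / (4 * X.2)))
  else 0

/-- The standard parabolic cylinder `C_r(Y) = B_r(y) × (s - r², s)`, where `Y = (y, s)`. -/
def parabolicCylinder (Y : SpaceTime n) (r : ℝ) : Set (SpaceTime n) :=
  Metric.ball Y.1 r ×ˢ Ioo (Y.2 - r ^ 2) Y.2

/-- The parabolic boundary `∂_p Q`: the points `(x₀, t₀)` of the topological boundary of `Q` for
which there are `δ > 0` and a continuous curve `x : [t₀, t₀ + δ) → ℝⁿ` with `x(t₀) = x₀` and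
`(x(t), t) ∈ Q` for all `t ∈ (t₀, t₀ + δ)`. -/
def parabolicBoundary (Q : Set (SpaceTime n)) : Set (SpaceTime n) :=
  {X₀ | X₀ ∈ frontier Q ∧ ∃ δ : ℝ, 0 < δ ∧ ∃ x : ℝ → EuclideanSpace ℝ (Fin n),
    ContinuousOn x (Ico X₀.2 (X₀.2 + δ)) ∧ x X₀.2 = X₀.1 ∧
      ∀ t ∈ Ioo X₀.2 (X₀.2 + δ), (x t, t) ∈ Q}

/-- The heat shell `{Y : b ≥ F(Y₀ - Y) ≥ a}`. -/
def heatShell (Y₀ : SpaceTime n) (a b : ℝ) : Set (SpaceTime n) :=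
  {Y | a ≤ heatKernel (Y₀ - Y) ∧ heatKernel (Y₀ - Y) ≤ b}

/-- Condition (A), the exterior measure condition. -/
def ConditionA (Q : Set (SpaceTime n)) : Prop :=
  ∃ θ₀ ∈ Ioo (0 : ℝ) 1, ∀ Y₀ ∈ parabolicBoundary Q, ∀ r : ℝ, 0 < r →
    ENNReal.ofReal θ₀ * volume (parabolicCylinder Y₀ r) < volume (parabolicCylinder Y₀ r \ Q)

/-- Condition (B), the exterior measure condition on heat shells. Here `k₀` and `k` range over the
positive integers; `θ₁` depends on `Q` only, while `k₀` may depend on `Y₀` and `l`. -/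
def ConditionB (Q : Set (SpaceTime n)) : Prop :=
  ∃ θ₁ ∈ Ioo (0 : ℝ) 1, ∀ Y₀ ∈ parabolicBoundary Q, ∀ l : ℝ, 1 < l →
    ∃ k₀ : ℕ, 1 ≤ k₀ ∧ ∀ k : ℕ, 1 ≤ k →
      ENNReal.ofReal θ₁ * volume (heatShell Y₀ ((l ^ k₀) ^ k) ((l ^ k₀) ^ (k + 1))) <
        volume (heatShell Y₀ ((l ^ k₀) ^ k) ((l ^ k₀) ^ (k + 1)) \ Q)

/-- The thermal potential `(F * μ)(X) = ∫ F(X - Y) dμ(Y) ∈ [0, ∞]`. -/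
def heatPotential (μ : Measure (SpaceTime n)) (X : SpaceTime n) : ℝ≥0∞ :=
  ∫⁻ Y, ENNReal.ofReal (heatKernel (X - Y)) ∂μ

/-- The thermal capacity `cap(K) = sup {μ(ℝⁿ⁺¹)}`, over the nonnegative Radon measures `μ` carried
by `K` with `F * μ ≤ 1` everywhere. Radon measures on `ℝⁿ⁺¹` are the locally finite Borel measures.
For closed `K`, `μ(Kᶜ) = 0` says that the support of `μ` lies in `K`. For Borel `K`, the value is
the supremum of the capacities of the compact subsets of `K`, because restricting `μ` to a compact
subset decreases `F * μ`, and `μ` is inner regular. -/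
def thermalCapacity (K : Set (SpaceTime n)) : ℝ≥0∞ :=
  sSup {m | ∃ μ : Measure (SpaceTime n), IsLocallyFiniteMeasure μ ∧ μ Kᶜ = 0 ∧
    (∀ X, heatPotential μ X ≤ 1) ∧ m = μ univ}

/-- `X₀` is regular for `Q`, in the sense of Wiener's criterion for the heat equation: for every
`l > 1`, the series `∑_{k ≥ 1} l^k cap(Qᶜ ∩ {l^(k+1) ≥ F(X₀ - X) ≥ l^k})` diverges. The summation
index `j` below is `k - 1`. -/
def WienerRegular (Q : Set (SpaceTime n)) (X₀ : SpaceTime n) : Prop :=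
  ∀ l : ℝ, 1 < l →
    ∑' j : ℕ, ENNReal.ofReal (l ^ (j + 1)) *
      thermalCapacity (Qᶜ ∩ heatShell X₀ (l ^ (j + 1)) (l ^ (j + 2))) = ∞

end ThermalWiener

end

namespace ThermalWiener

open MeasureTheory Set
open scoped ENNReal

variable {n : ℕ}

/-! Capacity is bounded below by volume. The set `{F(X - ·) ≥ a}` lies in a time slab of height `T =
1/(4π a^(2/n))`, and Lebesgue measure on such a slab has potential at most `T`, since `F` has mass
at most 1 at each time. Hence `cap K ≥ |K|/T` for measurable `K` in that set
(`volume_le_thermalCapacity`), and a Wiener term at level `a` is at least a constant times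
`a^(1+2/n)` times the exterior volume in the shell. With `r^n` proportional to `1/a`, a parabolic
slice of size `r`, of volume proportional to `r^(n+2)`, that is to `a^(-(1+2/n))`, fits in a
sufficiently wide shell (`parabolicSlice_subset_heatShell`). If the exterior volume in that shell is
at least a fixed fraction of the slice, each block of `k₀` consecutive terms has sum bounded below,
so the series diverges (`wienerSum_eq_top_of_slice_le`). Both conditions supply this fraction; (A)
is treated directly, without passing through (B). -/

/-! ### Lower bound of capacity by volume. -/

lemma heatKernel_of_pos {X : SpaceTime n} (h : 0 < X.2) :
    heatKernel X = (4 * Real.pi * X.2) ^ (-(n : ℝ) / 2) *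
      Real.exp (-(‖X.1‖ ^ 2 / (4 * X.2))) := if_pos h

lemma measurable_heatKernel : Measurable (heatKernel : SpaceTime n → ℝ) := by
  unfold heatKernel
  refine Measurable.ite (measurableSet_lt measurable_const measurable_snd) ?_ measurable_const
  fun_prop

lemma measurableSet_heatShell (Y : SpaceTime n) (a b : ℝ) : MeasurableSet (heatShell Y a b) := by
  have h : Measurable fun X : SpaceTime n => heatKernel (Y - X) :=
    measurable_heatKernel.comp (measurable_const.sub measurable_id)
  exact (measurableSet_le measurable_const h).inter (measurableSet_le h measurable_const)

/-- The total heat at each positive time is `1`. -/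
lemma lintegral_heatKernel_le_one (t : ℝ) :
    ∫⁻ x : EuclideanSpace ℝ (Fin n), ENNReal.ofReal (heatKernel (x, t)) ≤ 1 := by
  by_cases ht : 0 < t
  · have key := GaussianFourier.integral_rexp_neg_mul_sq_norm
      (V := EuclideanSpace ℝ (Fin n)) (b := 1 / (4 * t)) (by positivity)
    have hpos : 0 < (Real.pi / (1 / (4 * t))) ^
        ((Module.finrank ℝ (EuclideanSpace ℝ (Fin n)) : ℝ) / 2) := by positivity
    have hint : Integrable fun x : EuclideanSpace ℝ (Fin n) =>
        Real.exp (-(1 / (4 * t)) * ‖x‖ ^ 2) := by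
      -- A non-integrable function has Bochner integral 0, which the positive value in `key`
      -- excludes.
      by_contra h
      rw [integral_undef h] at key
      exact hpos.ne key
    have heq : ∀ x : EuclideanSpace ℝ (Fin n), heatKernel (x, t) =
        (4 * Real.pi * t) ^ (-(n : ℝ) / 2) * Real.exp (-(1 / (4 * t)) * ‖x‖ ^ 2) := by
      intro x
      rw [heatKernel_of_pos (X := (x, t)) ht]
      congr 2
      ring
    simp_rw [heq]
    rw [← ofReal_integral_eq_lintegral_ofReal (hint.const_mul _)
      (ae_of_all _ fun x => by positivity), integral_const_mul, key]
    have h2 : Real.pi / (1 / (4 * t)) = 4 * Real.pi * t := by field_simp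
    rw [h2, finrank_euclideanSpace_fin, ← Real.rpow_add (by positivity)]
    have h3 : -(n : ℝ) / 2 + n / 2 = 0 := by ring
    simp [h3]
  · simp [heatKernel, ht]

/-- The potential of Lebesgue measure on a slab is at most the height of the slab. -/
lemma setLIntegral_heatKernel_le (X : SpaceTime n) (s T : ℝ) :
    ∫⁻ Y in univ ×ˢ Icc (s - T) s, ENNReal.ofReal (heatKernel (X - Y)) ≤ ENNReal.ofReal T := by
  have hm : Measurable fun Y : SpaceTime n => ENNReal.ofReal (heatKernel (X - Y)) :=
    (measurable_heatKernel.comp (measurable_const.sub measurable_id)).ennreal_ofReal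
  rw [Measure.volume_eq_prod, ← Measure.prod_restrict, Measure.restrict_univ,
    lintegral_prod_symm _ hm.aemeasurable]
  calc _ ≤ ∫⁻ _ in Icc (s - T) s, 1 := by
        refine lintegral_mono fun t => ?_
        have := lintegral_sub_left_eq_self (μ := (volume : Measure (EuclideanSpace ℝ (Fin n))))
          (fun x => ENNReal.ofReal (heatKernel (x, X.2 - t))) X.1
        exact this.trans_le (lintegral_heatKernel_le_one _)
    _ = _ := by simp

/-- A superlevel set of the heat kernel lies in a slab. -/
lemma time_mem_Icc_of_le_heatKernel (hn : 1 ≤ n) {X Y : SpaceTime n} {a : ℝ} (ha : 0 < a)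
    (h : a ≤ heatKernel (X - Y)) : Y.2 ∈ Icc (X.2 - (4 * Real.pi * a ^ (2 / (n : ℝ)))⁻¹) X.2 := by
  have hn' : (0 : ℝ) < n := by exact_mod_cast hn
  have ht : 0 < (X - Y).2 := by
    by_contra hc
    rw [heatKernel, if_neg hc] at h
    linarith
  have hb : 0 < 4 * Real.pi * (X - Y).2 := by positivity
  rw [heatKernel_of_pos ht] at h
  have h1 : a ≤ (4 * Real.pi * (X - Y).2) ^ (-(n : ℝ) / 2) := by
    refine h.trans (mul_le_of_le_one_right (by positivity) (Real.exp_le_one_iff.2 ?_))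
    have : 0 ≤ ‖(X - Y).1‖ ^ 2 / (4 * (X - Y).2) := by positivity
    linarith
  have h2 := Real.rpow_le_rpow ha.le h1 (by positivity : 0 ≤ 2 / (n : ℝ))
  rw [← Real.rpow_mul hb.le, show -(n : ℝ) / 2 * (2 / n) = -1 by field_simp,
    Real.rpow_neg_one] at h2
  have hp : 0 < a ^ (2 / (n : ℝ)) := Real.rpow_pos_of_pos ha _
  have h3 : (X - Y).2 ≤ (4 * Real.pi * a ^ (2 / (n : ℝ)))⁻¹ := by
    rw [le_inv_comm₀ ht (by positivity)]
    have h4 : 4 * Real.pi * a ^ (2 / (n : ℝ)) ≤ 4 * Real.pi * (4 * Real.pi * (X - Y).2)⁻¹ := by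
      gcongr
    refine h4.trans_eq ?_
    have := ht.ne'
    field_simp
  simp only [Prod.snd_sub] at ht h3
  exact ⟨by linarith, by linarith⟩

/-- Testing the capacity with a multiple of Lebesgue measure. -/
lemma volume_le_thermalCapacity (hn : 1 ≤ n) {X : SpaceTime n} {a : ℝ} (ha : 0 < a)
    {K : Set (SpaceTime n)} (hK : MeasurableSet K) (hKa : ∀ Y ∈ K, a ≤ heatKernel (X - Y)) :
    ENNReal.ofReal (4 * Real.pi * a ^ (2 / (n : ℝ))) * volume K ≤ thermalCapacity K := by
  set c := 4 * Real.pi * a ^ (2 / (n : ℝ)) with hc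
  have hcpos : 0 < c := by positivity
  -- The density `c` is the reciprocal of the height of the slab containing `K`.
  refine le_sSup ⟨c.toNNReal • volume.restrict K, inferInstance, ?_, ?_, ?_⟩
  · simp [Measure.restrict_apply hK.compl]
  · intro Z
    have hsub : K ⊆ univ ×ˢ Icc (X.2 - c⁻¹) X.2 := fun Y hY =>
      ⟨mem_univ _, time_mem_Icc_of_le_heatKernel hn ha (hKa Y hY)⟩
    have h1 := (lintegral_mono_set (μ := volume)
      (f := fun Y => ENNReal.ofReal (heatKernel (Z - Y))) hsub).trans
        (setLIntegral_heatKernel_le Z X.2 c⁻¹)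
    rw [heatPotential, lintegral_smul_measure]
    calc _ ≤ ENNReal.ofReal c * ENNReal.ofReal c⁻¹ := mul_le_mul_right h1 _
      _ = 1 := by rw [← ENNReal.ofReal_mul hcpos.le, mul_inv_cancel₀ hcpos.ne', ENNReal.ofReal_one]
  · rw [Measure.smul_apply, Measure.restrict_apply_univ]
    rfl

/-! ### Divergence by blocks of shells. -/

lemma volume_heatShell_diff_le_sum (Q : Set (SpaceTime n)) (X : SpaceTime n) (l : ℝ) (p : ℕ)
    {d : ℕ} (hd : 1 ≤ d) :
    volume (heatShell X (l ^ p) (l ^ (p + d)) \ Q) ≤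
      ∑ i ∈ Finset.range d, volume (heatShell X (l ^ (p + i)) (l ^ (p + i + 1)) \ Q) := by
  induction d, hd using Nat.le_induction with
  | base => simp
  | succ d hd ih =>
    rw [Finset.sum_range_succ]
    refine le_trans ?_ (add_le_add_left ih _)
    refine (measure_mono ?_).trans (measure_union_le _ _)
    rintro Y ⟨⟨h1, h2⟩, hQ⟩
    rcases le_total (heatKernel (X - Y)) (l ^ (p + d)) with h | h
    · exact Or.inl ⟨⟨h1, h⟩, hQ⟩
    · exact Or.inr ⟨⟨h, h2⟩, hQ⟩

lemma wienerSum_eq_top_of_volume_le (hn : 1 ≤ n) {Q : Set (SpaceTime n)} (hQ : IsOpen Q)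
    {X : SpaceTime n} {l : ℝ} (hl : 1 < l) {k₀ : ℕ} (hk₀ : 1 ≤ k₀) {c : ℝ≥0∞} (hc : c ≠ 0)
    (h : ∀ k : ℕ, 1 ≤ k → c ≤
      ENNReal.ofReal ((l ^ k₀) ^ k * (4 * Real.pi * ((l ^ k₀) ^ k) ^ (2 / (n : ℝ)))) *
        volume (heatShell X ((l ^ k₀) ^ k) ((l ^ k₀) ^ (k + 1)) \ Q)) :
    ∑' j : ℕ, ENNReal.ofReal (l ^ (j + 1)) *
      thermalCapacity (Qᶜ ∩ heatShell X (l ^ (j + 1)) (l ^ (j + 2))) = ∞ := by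
  have hl0 : 0 < l := by linarith
  set f : ℕ → ℝ≥0∞ := fun j => ENNReal.ofReal (l ^ (j + 1)) *
      thermalCapacity (Qᶜ ∩ heatShell X (l ^ (j + 1)) (l ^ (j + 2))) with hf
  -- The weight increases with the level, so the lowest level `l ^ p` of a block may replace that of
  -- each of its shells.
  have hterm : ∀ p q j : ℕ, p ≤ q → q = j + 1 →
      ENNReal.ofReal (l ^ p * (4 * Real.pi * (l ^ p) ^ (2 / (n : ℝ)))) *
        volume (heatShell X (l ^ q) (l ^ (q + 1)) \ Q) ≤ f j := by
    rintro p q j hpq rfl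
    have hcap := volume_le_thermalCapacity hn (X := X) (a := l ^ (j + 1)) (by positivity)
      (K := Qᶜ ∩ heatShell X (l ^ (j + 1)) (l ^ (j + 2)))
      (hQ.measurableSet.compl.inter (measurableSet_heatShell _ _ _)) (fun Y hY => hY.2.1)
    have hpow : l ^ p ≤ l ^ (j + 1) := pow_le_pow_right₀ hl.le hpq
    calc _ ≤ ENNReal.ofReal (l ^ (j + 1) * (4 * Real.pi * (l ^ (j + 1)) ^ (2 / (n : ℝ)))) *
          volume (heatShell X (l ^ (j + 1)) (l ^ (j + 1 + 1)) \ Q) := by gcongr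
      _ = ENNReal.ofReal (l ^ (j + 1)) * (ENNReal.ofReal (4 * Real.pi *
          (l ^ (j + 1)) ^ (2 / (n : ℝ))) *
            volume (Qᶜ ∩ heatShell X (l ^ (j + 1)) (l ^ (j + 2)))) := by
        rw [ENNReal.ofReal_mul (by positivity), mul_assoc, sdiff_eq, inter_comm]
      _ ≤ _ := mul_le_mul_right hcap _
  -- Blocks start at exponent `k₀`, hence at index `k₀ - 1`, because index `j` carries exponent `j +
  -- 1`.
  have hblock : ∀ N : ℕ, c ≤ ∑ i ∈ Finset.range k₀, f (k₀ - 1 + (k₀ * N + i)) := by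
    intro N
    refine (h (N + 1) (by omega)).trans ?_
    rw [← pow_mul, ← pow_mul, show k₀ * (N + 1 + 1) = k₀ * (N + 1) + k₀ by ring]
    refine (mul_le_mul_right (volume_heatShell_diff_le_sum Q X l _ hk₀) _).trans ?_
    rw [Finset.mul_sum]
    refine Finset.sum_le_sum fun i _ => hterm _ _ _ (by omega) ?_
    rw [mul_add]
    omega
  have hsum : ∀ N : ℕ, N * c ≤ ∑ j ∈ Finset.range (k₀ * N), f (k₀ - 1 + j) := by
    intro N
    induction N with
    | zero => simp
    | succ N ih =>
      rw [mul_add, mul_one, Finset.sum_range_add, Nat.cast_succ, add_mul, one_mul]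
      exact add_le_add ih (hblock N)
  by_contra hS
  obtain ⟨N, hN⟩ := ENNReal.exists_nat_mul_gt hc hS
  refine hN.not_ge ((hsum N).trans ((ENNReal.sum_le_tsum _).trans ?_))
  exact ENNReal.tsum_comp_le_tsum_of_injective (add_right_injective (k₀ - 1)) f

/-! ### Parabolic slices inside heat shells. -/

/-- The part of a parabolic cylinder of radius `R r` with backward times in `(α r², β r²)`. -/
def parabolicSlice (X : SpaceTime n) (α β R r : ℝ) : Set (SpaceTime n) :=
  Metric.ball X.1 (R * r) ×ˢ Ioo (X.2 - β * r ^ 2) (X.2 - α * r ^ 2)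

lemma volume_ball_prod (x : EuclideanSpace ℝ (Fin n)) {ρ : ℝ} (hρ : 0 < ρ) (I : Set ℝ) :
    volume (Metric.ball x ρ ×ˢ I) = ENNReal.ofReal (ρ ^ n) *
      volume (Metric.ball (0 : EuclideanSpace ℝ (Fin n)) 1) * volume I := by
  rw [Measure.volume_eq_prod, Measure.prod_prod, Measure.addHaar_ball_of_pos _ _ hρ,
    finrank_euclideanSpace_fin]

lemma volume_parabolicSlice (X : SpaceTime n) (α β : ℝ) {R r : ℝ} (hR : 0 < R) (hr : 0 < r) :
    volume (parabolicSlice X α β R r) = ENNReal.ofReal (r ^ n * r ^ 2) *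
      (ENNReal.ofReal (R ^ n * (β - α)) *
        volume (Metric.ball (0 : EuclideanSpace ℝ (Fin n)) 1)) := by
  rw [parabolicSlice, volume_ball_prod _ (by positivity), Real.volume_Ioo, mul_right_comm,
    ← ENNReal.ofReal_mul (by positivity), ← mul_assoc, ← ENNReal.ofReal_mul (by positivity)]
  congr 2
  ring

lemma rpow_mul_sq_neg_half {β r : ℝ} (hβ : 0 < β) (hr : 0 < r) :
    (4 * Real.pi * (β * r ^ 2)) ^ (-(n : ℝ) / 2) =
      (4 * Real.pi * β) ^ (-(n : ℝ) / 2) / r ^ n := by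
  rw [← mul_assoc, Real.mul_rpow (by positivity) (by positivity), ← Real.rpow_natCast r 2,
    ← Real.rpow_mul hr.le, div_eq_mul_inv _ (r ^ n), ← Real.rpow_natCast r n, ← Real.rpow_neg hr.le]
  congr 2
  push_cast
  ring

/-- By parabolic scaling the kernel is `r^(-n)` times its unit-scale value. The lower bound takes
the latest backward time `β` in the power and the earliest, `α`, in the exponential; the upper bound
drops the exponential. -/
lemma parabolicSlice_subset_heatShell (X : SpaceTime n) {α β R r : ℝ} (hα : 0 < α) (hαβ : α < β)
    (hR : 0 < R) (hr : 0 < r) :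
    parabolicSlice X α β R r ⊆
      heatShell X ((4 * Real.pi * β) ^ (-(n : ℝ) / 2) * Real.exp (-(R ^ 2 / (4 * α))) / r ^ n)
        ((4 * Real.pi * α) ^ (-(n : ℝ) / 2) / r ^ n) := by
  rintro Y ⟨hx, ht1, ht2⟩
  have hβ : 0 < β := hα.trans hαβ
  have hr2 : 0 < r ^ 2 := by positivity
  have h1 : α * r ^ 2 < (X - Y).2 := by simp only [Prod.snd_sub]; linarith
  have h2 : (X - Y).2 < β * r ^ 2 := by simp only [Prod.snd_sub]; linarith
  have h0 : 0 < (X - Y).2 := lt_trans (by positivity) h1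
  have h3 : ‖(X - Y).1‖ ≤ R * r := by
    rw [Metric.mem_ball, dist_comm, dist_eq_norm] at hx
    exact hx.le
  have hexp : -(n : ℝ) / 2 ≤ 0 := by
    have : (0 : ℝ) ≤ n := n.cast_nonneg
    linarith
  refine ⟨?_, ?_⟩
  · rw [heatKernel_of_pos h0, mul_div_right_comm, ← rpow_mul_sq_neg_half hβ hr]
    refine mul_le_mul ?_ ?_ (by positivity) (by positivity)
    · exact Real.rpow_le_rpow_of_nonpos (by positivity) (by gcongr) hexp
    · refine Real.exp_le_exp.2 (neg_le_neg ?_)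
      calc ‖(X - Y).1‖ ^ 2 / (4 * (X - Y).2) ≤ (R * r) ^ 2 / (4 * (α * r ^ 2)) := by gcongr
        _ = R ^ 2 / (4 * α) := by field_simp
  · rw [heatKernel_of_pos h0, ← rpow_mul_sq_neg_half hα hr]
    have hle : (4 * Real.pi * (X - Y).2) ^ (-(n : ℝ) / 2) ≤
        (4 * Real.pi * (α * r ^ 2)) ^ (-(n : ℝ) / 2) :=
      Real.rpow_le_rpow_of_nonpos (by positivity) (by gcongr) hexp
    refine (mul_le_of_le_one_right (by positivity) (Real.exp_le_one_iff.2 ?_)).trans hle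
    have : 0 ≤ ‖(X - Y).1‖ ^ 2 / (4 * (X - Y).2) := by positivity
    linarith

/-- The Wiener series diverges once `Qᶜ` fills a fixed fraction of comparable parabolic slices
inside the heat shells. -/
lemma wienerSum_eq_top_of_slice_le (hn : 1 ≤ n) {Q : Set (SpaceTime n)} (hQ : IsOpen Q)
    {X : SpaceTime n} {l : ℝ} (hl : 1 < l) {k₀ : ℕ} (hk₀ : 1 ≤ k₀) {α β R θ κ : ℝ}
    (hαβ : α < β) (hR : 0 < R) (hθ : 0 < θ) (hκ : 0 < κ)
    (h : ∀ r : ℝ, 0 < r → ∀ k : ℕ, 1 ≤ k → κ / r ^ n = (l ^ k₀) ^ k →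
      ENNReal.ofReal θ * volume (parabolicSlice X α β R r) ≤
        volume (heatShell X ((l ^ k₀) ^ k) ((l ^ k₀) ^ (k + 1)) \ Q)) :
    ∑' j : ℕ, ENNReal.ofReal (l ^ (j + 1)) *
      thermalCapacity (Qᶜ ∩ heatShell X (l ^ (j + 1)) (l ^ (j + 2))) = ∞ := by
  have hl0 : 0 < l := by linarith
  have hn' : (n : ℝ) ≠ 0 := by exact_mod_cast (by omega : n ≠ 0)
  -- The scale cancels: with `r^n = κ/a`, the product `a^(1+2/n) r^(n+2)` equals `κ^(1+2/n)`.
  set c : ℝ≥0∞ := ENNReal.ofReal (κ * (4 * Real.pi * κ ^ (2 / (n : ℝ)))) * (ENNReal.ofReal θ *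
    (ENNReal.ofReal (R ^ n * (β - α)) *
      volume (Metric.ball (0 : EuclideanSpace ℝ (Fin n)) 1))) with hc
  have hβα : 0 < β - α := by linarith
  have hball : volume (Metric.ball (0 : EuclideanSpace ℝ (Fin n)) 1) ≠ 0 :=
    (Metric.measure_ball_pos _ _ one_pos).ne'
  have hc0 : c ≠ 0 := by
    refine mul_ne_zero ?_ (mul_ne_zero ?_ (mul_ne_zero ?_ hball)) <;>
      exact (ENNReal.ofReal_pos.2 (by positivity)).ne'
  refine wienerSum_eq_top_of_volume_le hn hQ hl hk₀ hc0 fun k hk => ?_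
  set a := (l ^ k₀) ^ k with ha
  have ha0 : 0 < a := by positivity
  set r := (κ / a) ^ ((n : ℝ)⁻¹) with hr
  have hr0 : 0 < r := by positivity
  have hrn : r ^ n = κ / a := Real.rpow_inv_natCast_pow (by positivity) (by omega)
  have hr2 : r ^ 2 = κ ^ (2 / (n : ℝ)) / a ^ (2 / (n : ℝ)) := by
    rw [← Real.div_rpow hκ.le ha0.le, hr, ← Real.rpow_natCast, ← Real.rpow_mul (by positivity)]
    congr 1
    push_cast
    ring
  refine le_trans (le_of_eq ?_) (mul_le_mul_right
    (h r hr0 k hk (by rw [hrn, div_div_cancel₀ hκ.ne'])) _)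
  rw [volume_parabolicSlice X α β hR hr0, mul_left_comm (ENNReal.ofReal θ), ← mul_assoc,
    ← ENNReal.ofReal_mul (by positivity), hc, hrn, hr2]
  congr 2
  have := (Real.rpow_pos_of_pos ha0 (2 / (n : ℝ))).ne'
  field_simp

/-! ### The two measure conditions. -/

theorem ConditionB.wienerRegular (hn : 1 ≤ n) {Q : Set (SpaceTime n)} (hQ : IsOpen Q)
    (hB : ConditionB Q) {X : SpaceTime n} (hX : X ∈ parabolicBoundary Q) : WienerRegular Q X := by
  intro l hl
  obtain ⟨θ, ⟨hθ, -⟩, hB⟩ := hB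
  obtain ⟨k₀, hk₀, hB⟩ := hB X hX l hl
  have hn' : (0 : ℝ) < n := by exact_mod_cast hn
  set m := l ^ k₀ with hm
  have hm1 : 1 < m := one_lt_pow₀ hl (by omega)
  have hm0 : 0 < m := by linarith
  have hlog : 0 < Real.log m := Real.log_pos hm1
  -- With `α = 1`, these `β` and `R` make the power and the exponential each lose a factor
  -- `m^(1/2)`, so the kernel bounds on the slice differ by exactly `m`.
  set β := m ^ (1 / (n : ℝ)) with hβ
  have hβ1 : 1 < β := Real.one_lt_rpow hm1 (by positivity)
  have hβ0 : 0 < β := by linarith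
  set R := √(2 * Real.log m) with hRdef
  have hR : 0 < R := by positivity
  set κ := (4 * Real.pi * β) ^ (-(n : ℝ) / 2) * Real.exp (-(R ^ 2 / (4 * 1))) with hκ
  have hκm : m * κ = (4 * Real.pi * 1) ^ (-(n : ℝ) / 2) := by
    have h1 : β ^ (-(n : ℝ) / 2) = Real.exp (-(Real.log m / 2)) := by
      rw [hβ, ← Real.rpow_mul hm0.le, Real.rpow_def_of_pos hm0]
      congr 1
      field_simp
    have h2 : R ^ 2 / (4 * 1) = Real.log m / 2 := by
      rw [hRdef, Real.sq_sqrt (by positivity)]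
      ring
    rw [hκ, Real.mul_rpow (by positivity) hβ0.le, h1, h2, mul_one, mul_assoc, ← Real.exp_add,
      show -(Real.log m / 2) + -(Real.log m / 2) = -Real.log m by ring, Real.exp_neg,
      Real.exp_log hm0]
    field_simp
  refine wienerSum_eq_top_of_slice_le hn hQ hl hk₀ hβ1 hR hθ (κ := κ) (by positivity)
    fun r hr k hk hrk => ?_
  refine le_trans (mul_le_mul_right (measure_mono ?_) _) (hB k hk).le
  have h := parabolicSlice_subset_heatShell X one_pos hβ1 hR hr
  rwa [← hκ, ← hκm, mul_div_assoc m, hrk, ← pow_succ'] at h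

theorem ConditionA.wienerRegular (hn : 1 ≤ n) {Q : Set (SpaceTime n)} (hQ : IsOpen Q)
    (hA : ConditionA Q) {X : SpaceTime n} (hX : X ∈ parabolicBoundary Q) : WienerRegular Q X := by
  intro l hl
  obtain ⟨θ, ⟨hθ, hθ1⟩, hA⟩ := hA
  -- The latest times, of backward length `ε r²`, take up a fraction `θ/2` of the cylinder, so an
  -- exterior fraction `θ/2` remains in the slice below them.
  set ε := θ / 2 with hε
  have hε0 : 0 < ε := by positivity
  have hε1 : ε < 1 := by linarith
  set κ := (4 * Real.pi * 1) ^ (-(n : ℝ) / 2) * Real.exp (-((1 : ℝ) ^ 2 / (4 * ε))) with hκ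
  have hκ0 : 0 < κ := by positivity
  -- Blocks are taken long enough to cover the ratio of the kernel bounds on the slice; `k₀ + 1` is
  -- used to have positive length.
  obtain ⟨k₀, hk₀⟩ := pow_unbounded_of_one_lt ((4 * Real.pi * ε) ^ (-(n : ℝ) / 2) / κ) hl
  have hk : (4 * Real.pi * ε) ^ (-(n : ℝ) / 2) ≤ l ^ (k₀ + 1) * κ :=
    (div_le_iff₀ hκ0).1 (hk₀.le.trans (pow_le_pow_right₀ hl.le (Nat.le_succ _)))
  refine wienerSum_eq_top_of_slice_le hn hQ hl (Nat.le_add_left 1 k₀) hε1 one_pos hε0 hκ0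
    fun r hr k _ hrk => ?_
  set m := l ^ (k₀ + 1) with hm
  have hsub : parabolicSlice X ε 1 1 r ⊆ heatShell X (m ^ k) (m ^ (k + 1)) := by
    intro Y hY
    obtain ⟨h1, h2⟩ := parabolicSlice_subset_heatShell X hε0 hε1 one_pos hr hY
    rw [← hκ, hrk] at h1
    refine ⟨h1, h2.trans ?_⟩
    calc _ ≤ m * κ / r ^ n := by gcongr
      _ = m ^ (k + 1) := by rw [mul_div_assoc, hrk, pow_succ']
  refine le_trans ?_ (measure_mono (sdiff_subset_sdiff_left hsub))
  set V := volume (parabolicCylinder X r) with hV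
  have hVeq : V = ENNReal.ofReal (r ^ n) *
      volume (Metric.ball (0 : EuclideanSpace ℝ (Fin n)) 1) * ENNReal.ofReal (r ^ 2) := by
    rw [hV, parabolicCylinder, volume_ball_prod _ hr, Real.volume_Ioo]
    congr 2
    ring
  have hVtop : V ≠ ∞ := by
    rw [hVeq]
    exact ENNReal.mul_ne_top (ENNReal.mul_ne_top ENNReal.ofReal_ne_top measure_ball_lt_top.ne)
      ENNReal.ofReal_ne_top
  have htop : volume (Metric.ball X.1 r ×ˢ Ico (X.2 - ε * r ^ 2) X.2) = ENNReal.ofReal ε * V := by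
    rw [volume_ball_prod _ hr, Real.volume_Ico, hVeq, sub_sub_cancel, ENNReal.ofReal_mul hε0.le]
    ring
  have hcover : parabolicCylinder X r \ Q ⊆ (parabolicSlice X ε 1 1 r \ Q) ∪
      Metric.ball X.1 r ×ˢ Ico (X.2 - ε * r ^ 2) X.2 := by
    rintro Y ⟨⟨hx, ht1, ht2⟩, hYQ⟩
    rcases lt_or_ge Y.2 (X.2 - ε * r ^ 2) with h | h
    · exact Or.inl ⟨⟨by rwa [one_mul], by rwa [one_mul], h⟩, hYQ⟩
    · exact Or.inr ⟨hx, h, ht2⟩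
  have hslice : volume (parabolicSlice X ε 1 1 r) ≤ V := by
    refine measure_mono ?_
    rintro Y ⟨hx, ht1, ht2⟩
    rw [one_mul] at hx ht1
    have : 0 < ε * r ^ 2 := by positivity
    exact ⟨hx, ht1, by linarith⟩
  have hlt := (hA X hX r hr).trans_le ((measure_mono hcover).trans (measure_union_le _ _))
  rw [htop, show θ = ε + ε by rw [hε]; ring, ENNReal.ofReal_add hε0.le hε0.le, add_mul] at hlt
  exact (mul_le_mul_right hslice _).trans
    (ENNReal.le_of_add_le_add_right (ENNReal.mul_ne_top ENNReal.ofReal_ne_top hVtop) hlt.le)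

end ThermalWiener

theorem theoremA7 (n : ℕ) (hn : 1 ≤ n) (Q : Set (ThermalWiener.SpaceTime n)) (hQ : IsOpen Q) :
    (ThermalWiener.ConditionB Q →
      ∀ X₀ ∈ ThermalWiener.parabolicBoundary Q, ThermalWiener.WienerRegular Q X₀) ∧
    (ThermalWiener.ConditionA Q →
      ∀ X₀ ∈ ThermalWiener.parabolicBoundary Q, ThermalWiener.WienerRegular Q X₀) :=
  ⟨fun hB _ hX => hB.wienerRegular hn hQ hX, fun hA _ hX => hA.wienerRegular hn hQ hX⟩
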